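/- Let $(\Omega,\mathcal F,\mathbb P)$ be a probability space, let $1<p\le 2$ and $\frac1p+\frac1q=1$, and let $\mathcal C\subset\mathcal F$ be a sub-$\sigma$-algebra. Write $L^r_{\mathcal F}(\mathbb P)$ (resp. $L^r_{\mathcal C}(\mathbb P)$) for the space of $\mathcal F$-measurable (resp. $\mathcal C$-measurable) real random variables with integrable $r$-th absolute power, identified when $\mathbb P$-a.s. equal. Let $\rho:L^p_{\mathcal F}(\mathbb P)\to\mathbb R$ be a normalized convex operator, that is: $\rho(\xi_1)\ge\rho(\xi_2)$ whenever $\xi_1\ge\xi_2$ $\mathbb P$-a.s.; $\rho(\xi+c)=\rho(\xi)+c$ for every $c\in\mathbb R$; $\rho(\lambda\xi_1+(1-\lambda)\xi_2)\le\lambda\rho(\xi_1)+(1-\lambda)\rho(\xi_2)$ for every $\lambda\in[0,1]$; and $\rho(0)=0$. For a probability measure $P\ll\mathbb P$ put $f^P=\frac{dP}{d\mathbb P}$, and if $f^P\in L^q_{\mathcal F}(\mathbb P)$ put $\alpha(P)=\sup\{E_P[\zeta]:\zeta\in L^p_{\mathcal F}(\mathbb P),\ \rho(\zeta)\le 0\}\in[-\infty,\infty]$.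 The representation set of $\rho$ is $$\mathcal P=\{P:\ P\text{ is a probability measure},\ P\ll\mathbb P,\ f^P\in L^q_{\mathcal F}(\mathbb P),\ \alpha(P)<\infty\}.$$ Assume that * $\rho$ is proper: every $P\in\mathcal P$ is equivalent to $\mathbb P$; and * $\rho$ is stable: for every $P\in\mathcal P$ and every sub-$\sigma$-algebra $\mathcal G$ of $\mathcal F$, the random variable $f^P/\mathbb E[f^P\mid\mathcal G]$ is $\mathbb P$-a.s. equal to $f^Q$ for some $Q\in\mathcal P$. Then for every $\xi\in L^{4p}_{\mathcal F}(\mathbb P)$ there exists $\hat\eta\in L^{2p}_{\mathcal C}(\mathbb P)$ such that $$\rho\big((\xi-\hat\eta)^2\big)=\inf_{\eta\in L^{2p}_{\mathcal C}(\mathbb P)}\rho\big((\xi-\eta)^2\big).$$ -/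

import Mathlib

open MeasureTheory
open scoped ENNReal

namespace ConvexMMSE

variable {Ω : Type*} [mΩ : MeasurableSpace Ω]

/-- Convex operators on `L^p(Ω, ℱ, ℙ)`: monotone, constant invariant and convex.
The order on `Lp` is the almost sure order, and `Lp.const p ℙ c` is the class of the constant `c`. -/
structure IsConvexOperator (ℙ : Measure Ω) [IsProbabilityMeasure ℙ] (p : ℝ≥0∞)
    (ρ : Lp ℝ p ℙ → ℝ) : Prop where
  monotone : ∀ ξ₁ ξ₂ : Lp ℝ p ℙ, ξ₂ ≤ ξ₁ → ρ ξ₂ ≤ ρ ξ₁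
  constant_invariant : ∀ (ξ : Lp ℝ p ℙ) (c : ℝ), ρ (ξ + Lp.const p ℙ c) = ρ ξ + c
  convex : ∀ (ξ₁ ξ₂ : Lp ℝ p ℙ) (t : ℝ), 0 ≤ t → t ≤ 1 →
    ρ (t • ξ₁ + (1 - t) • ξ₂) ≤ t * ρ ξ₁ + (1 - t) * ρ ξ₂

/-- The operator is normalized. -/
def IsNormalized {ℙ : Measure Ω} {p : ℝ≥0∞} (ρ : Lp ℝ p ℙ → ℝ) : Prop :=
  ρ 0 = 0

/-- The Radon-Nikodym derivative `f^P = dP/dℙ`, real-valued. -/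
noncomputable def density (ℙ P : Measure Ω) : Ω → ℝ :=
  fun ω => (P.rnDeriv ℙ ω).toReal

/-- The acceptance set `{ζ ∈ L^p : ρ ζ ≤ 0}`. -/
def acceptanceSet {ℙ : Measure Ω} {p : ℝ≥0∞} (ρ : Lp ℝ p ℙ → ℝ) : Set (Lp ℝ p ℙ) :=
  {ζ | ρ ζ ≤ 0}

/-- The penalty `α(P)`, the supremum of `E_P[ζ]` over the acceptance set, with values in
`[-∞, ∞]`. It is used only for `P ≪ ℙ` with density in `L^q`, where every `ζ ∈ L^p` is
`P`-integrable. -/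
noncomputable def penalty {ℙ : Measure Ω} {p : ℝ≥0∞} (ρ : Lp ℝ p ℙ → ℝ) (P : Measure Ω) : EReal :=
  ⨆ ζ ∈ acceptanceSet ρ, ((∫ ω, ζ ω ∂P : ℝ) : EReal)

/-- The representation set of `ρ`: the probability measures `P ≪ ℙ` with density in `L^q`,
`1/p + 1/q = 1`, and finite penalty. -/
def representationSet {ℙ : Measure Ω} {p : ℝ≥0∞} (ρ : Lp ℝ p ℙ → ℝ) : Set (Measure Ω) :=
  {P | IsProbabilityMeasure P ∧ P ≪ ℙ ∧ MemLp (density ℙ P) p.conjExponent ℙ ∧ penalty ρ P < ⊤}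

/-- The quotient `f^P / 𝔼[f^P | 𝒞]`, for a sub-σ-algebra `𝒞`. -/
noncomputable def conditionalDensity (𝒞 : MeasurableSpace Ω) {mΩ : MeasurableSpace Ω}
    (ℙ P : Measure Ω) : Ω → ℝ :=
  fun ω => density ℙ P ω / (ℙ[density ℙ P | 𝒞]) ω

/-- `ρ` is stable: for each `P` in the representation set and each sub-σ-algebra `𝒞`, the quotient
`f^P / 𝔼[f^P | 𝒞]` is again the density of a member of the representation set. -/
def IsStable {ℙ : Measure Ω} {p : ℝ≥0∞} (ρ : Lp ℝ p ℙ → ℝ) : Prop :=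
  ∀ P ∈ representationSet ρ, ∀ 𝒞 : MeasurableSpace Ω, 𝒞 ≤ mΩ →
    ∃ Q ∈ @representationSet Ω mΩ ℙ p ρ,
      @density Ω mΩ ℙ Q =ᵐ[ℙ] @conditionalDensity Ω 𝒞 mΩ ℙ P

/-- `ρ` is proper: every member of the representation set is equivalent to `ℙ`. -/
def IsProper {ℙ : Measure Ω} {p : ℝ≥0∞} (ρ : Lp ℝ p ℙ → ℝ) : Prop :=
  ∀ P ∈ representationSet ρ, P ≪ ℙ ∧ ℙ ≪ P

theorem memLp_sq_sub {ℙ : Measure Ω} [IsProbabilityMeasure ℙ] {p : ℝ≥0∞}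
    (ξ : Lp ℝ (4 * p) ℙ) (η : Lp ℝ (2 * p) ℙ) :
    MemLp (fun ω => (ξ ω - η ω) ^ 2) p ℙ := by
  have h : MemLp (fun ω => ξ ω - η ω) (2 * p) ℙ :=
    ((Lp.memLp ξ).mono_exponent (by gcongr; norm_num)).sub (Lp.memLp η)
  have ht : ENNReal.HolderTriple (2 * p) (2 * p) p := by
    refine ⟨?_⟩
    rw [ENNReal.mul_inv (Or.inl (by norm_num)) (Or.inl (by norm_num)), ← add_mul,
      ENNReal.inv_two_add_inv_two, one_mul]
  simpa only [sq, Pi.mul_def] using h.mul h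

/-- The squared error `(ξ - η)^2 ∈ L^p` for `ξ ∈ L^{4p}` and `η ∈ L^{2p}`. -/
noncomputable def sqError {ℙ : Measure Ω} [IsProbabilityMeasure ℙ] {p : ℝ≥0∞}
    (ξ : Lp ℝ (4 * p) ℙ) (η : Lp ℝ (2 * p) ℙ) : Lp ℝ p ℙ :=
  (memLp_sq_sub ξ η).toLp (fun ω => (ξ ω - η ω) ^ 2)

end ConvexMMSE

/-! Write S η = (ξ - η)² and let V be the infimum of ρ(S η). The value function Φ(X) = inf over η of
ρ(S η + X) is finite and convex, so it has a subgradient at 0. Monotonicity and constant invariance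
make this subgradient positive and normalized, hence an expectation E_P with density in L^q. Testing
it at Y - S η gives V + E_P[Y] - E_P[S η] ≤ ρ(Y) for all Y and η (`exists_measure_iInf_add_le`); in
particular P has finite penalty.

The minimizer is η' = E_P[ξ | 𝒞]. Stability gives a measure Q with density f^P / 𝔼[f^P | 𝒞]. It has
the same conditional expectation of ξ but agrees with ℙ on 𝒞, which is what puts η' in L^{2p}(ℙ)
(`exists_projection`). For a minimizing sequence e_n, the inequality with Y = S e_n and η = η',
combined with Pythagoras under P, yields E_P[(e_n - η')²] ≤ ρ(S e_n) - V → 0. A subsequence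
converges P-a.s., hence ℙ-a.s. by properness, and the Fatou property of ρ (`le_of_tendsto_ae`) gives
ρ(S η') ≤ V. -/

namespace ConvexMMSE

/-! ### Subgradients, automatic continuity and an L^q criterion -/

/-- A real-valued convex function on a real vector space has an algebraic subgradient at `0`. -/
theorem exists_linear_le_sub_of_convexOn {E : Type*} [AddCommGroup E] [Module ℝ E] {Φ : E → ℝ}
    (hΦ : ConvexOn ℝ Set.univ Φ) : ∃ φ : E →ₗ[ℝ] ℝ, ∀ x, φ x ≤ Φ x - Φ 0 := by
  have hconv : ∀ (x y : E) (a b : ℝ), 0 ≤ a → 0 ≤ b → a + b = 1 →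
      Φ (a • x + b • y) ≤ a * Φ x + b * Φ y := fun x y a b ha hb hab =>
    hΦ.2 (Set.mem_univ x) (Set.mem_univ y) ha hb hab
  -- The infimum of these difference quotients is the directional derivative of Φ at 0. It is
  -- sublinear, so Hahn–Banach places a linear map below it.
  let S : E → Set ℝ := fun x => (fun t => (Φ (t • x) - Φ 0) / t) '' Set.Ioi 0
  have hmem : ∀ x t, 0 < t → (Φ (t • x) - Φ 0) / t ∈ S x := fun x t ht => ⟨t, ht, rfl⟩
  have hne : ∀ x, (S x).Nonempty := fun x => ⟨_, hmem x 1 one_pos⟩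
  have hbdd : ∀ x, BddBelow (S x) := by
    rintro x
    refine ⟨-(Φ (-x) - Φ 0), ?_⟩
    rintro _ ⟨t, ht, rfl⟩
    have ht : (0 : ℝ) < t := ht
    -- 0 is a convex combination of t • x and -x, which bounds the quotients along x from below.
    have h := hconv (t • x) (-x) (1 / (1 + t)) (t / (1 + t)) (by positivity) (by positivity) (by field_simp)
    have h0 : (1 / (1 + t)) • t • x + (t / (1 + t)) • -x = 0 := by
      rw [smul_smul, smul_neg, one_div_mul_eq_div, add_neg_cancel]
    rw [h0] at h
    have h1 : (1 + t) * Φ 0 ≤ Φ (t • x) + t * Φ (-x) := by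
      calc (1 + t) * Φ 0 ≤ (1 + t) * (1 / (1 + t) * Φ (t • x) + t / (1 + t) * Φ (-x)) := by gcongr
        _ = _ := by field_simp
    show _ ≤ (Φ (t • x) - Φ 0) / t
    rw [le_div_iff₀ ht]
    linarith
  let N : E → ℝ := fun x => sInf (S x)
  have hNle : ∀ x t, 0 < t → N x ≤ (Φ (t • x) - Φ 0) / t :=
    fun x t ht => csInf_le (hbdd x) (hmem x t ht)
  have hhom : ∀ c : ℝ, 0 < c → ∀ x, N (c • x) ≤ c * N x := by
    intro c hc x
    rw [← div_le_iff₀' hc]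
    refine le_csInf (hne x) ?_
    rintro _ ⟨t, ht, rfl⟩
    have ht : (0 : ℝ) < t := ht
    rw [div_le_iff₀' hc]
    refine (hNle (c • x) (t / c) (by positivity)).trans (le_of_eq ?_)
    rw [smul_smul, div_mul_cancel₀ _ hc.ne']
    field_simp
  have hadd : ∀ x y, N (x + y) ≤ N x + N y := by
    intro x y
    rw [← sub_le_iff_le_add]
    refine le_csInf (hne x) ?_
    rintro _ ⟨t, ht, rfl⟩
    rw [sub_le_comm]
    refine le_csInf (hne y) ?_
    rintro _ ⟨s, hs, rfl⟩
    have ht : (0 : ℝ) < t := ht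
    have hs : (0 : ℝ) < s := hs
    show N (x + y) - (Φ (t • x) - Φ 0) / t ≤ (Φ (s • y) - Φ 0) / s
    rw [sub_le_iff_le_add]
    -- With this step size, the multiple of x + y is a convex combination of t • x and s • y.
    refine (hNle (x + y) (t * s / (t + s)) (by positivity)).trans ?_
    have h := hconv (t • x) (s • y) (s / (t + s)) (t / (t + s)) (by positivity) (by positivity) (by field_simp; ring)
    have h0 : (s / (t + s)) • t • x + (t / (t + s)) • s • y = (t * s / (t + s)) • (x + y) := by
      rw [smul_smul, smul_smul, smul_add]
      congr 2 <;> ring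
    rw [h0] at h
    rw [div_le_iff₀ (by positivity)]
    have h2 : ((Φ (s • y) - Φ 0) / s + (Φ (t • x) - Φ 0) / t) * (t * s / (t + s))
        = s / (t + s) * Φ (t • x) + t / (t + s) * Φ (s • y) - Φ 0 := by
      field_simp
      ring
    rw [h2]
    linarith
  have hhom' : ∀ c : ℝ, 0 < c → ∀ x, N (c • x) = c * N x := by
    intro c hc x
    refine le_antisymm (hhom c hc x) ?_
    have h := hhom c⁻¹ (inv_pos.2 hc) (c • x)
    rw [smul_smul, inv_mul_cancel₀ hc.ne', one_smul] at h
    rwa [← div_eq_inv_mul, le_div_iff₀' hc] at h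
  have hN0 : N 0 = 0 := by
    have h := hhom' 2 two_pos 0
    rw [smul_zero] at h
    linarith
  obtain ⟨φ, -, hφ⟩ := exists_extension_of_le_sublinear (⊥ : E →ₗ.[ℝ] ℝ) N hhom' hadd (by
    rintro ⟨x, hx⟩
    obtain rfl : x = 0 := (Submodule.mem_bot ℝ).1 hx
    rw [hN0]
    exact le_of_eq (map_zero (⊥ : E →ₗ.[ℝ] ℝ).toFun))
  refine ⟨φ, fun x => (hφ x).trans ?_⟩
  simpa using hNle x 1 one_pos

/-- A positive linear functional on a Banach lattice is bounded. -/
theorem exists_bound_of_nonneg {E : Type*} [NormedAddCommGroup E] [NormedSpace ℝ E]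
    [CompleteSpace E] [Lattice E] [HasSolidNorm E] [IsOrderedAddMonoid E] (φ : E →ₗ[ℝ] ℝ)
    (hφ : ∀ x, 0 ≤ x → 0 ≤ φ x) : ∃ C, ∀ x, ‖φ x‖ ≤ C * ‖x‖ := by
  have hmono : ∀ x y, x ≤ y → φ x ≤ φ y := fun x y hxy => by
    simpa using hφ (y - x) (sub_nonneg.2 hxy)
  by_contra! h
  -- The factor 2 ^ n makes the rescaled vectors summable while φ has size n on the n-th one; φ of
  -- the sum of their absolute values would exceed every n.
  choose X hX using fun n : ℕ => h (n * 2 ^ n)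
  have hpos : ∀ n, 0 < ‖φ (X n)‖ := fun n => lt_of_le_of_lt (by positivity) (hX n)
  let Y : ℕ → E := fun n => ((n : ℝ) / ‖φ (X n)‖) • X n
  have hY : ∀ n, ‖|Y n|‖ ≤ (1 / 2) ^ n := by
    intro n
    rw [norm_abs_eq_norm, norm_smul, norm_div, norm_norm, Real.norm_natCast, div_mul_eq_mul_div,
      div_le_iff₀ (hpos n), one_div, inv_pow, ← div_eq_inv_mul, le_div_iff₀ (by positivity)]
    linarith [hX n]
  have hsum : Summable fun n => |Y n| :=
    Summable.of_norm_bounded summable_geometric_two hY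
  have hle : ∀ n : ℕ, (n : ℝ) ≤ φ (∑' k, |Y k|) := by
    intro n
    have h1 : φ |Y n| ≤ φ (∑' k, |Y k|) :=
      hmono _ _ (hsum.le_tsum n fun k _ => abs_nonneg (Y k))
    have h2 : ‖φ (Y n)‖ ≤ φ |Y n| := by
      rw [Real.norm_eq_abs, abs_le']
      refine ⟨hmono _ _ (le_abs_self _), ?_⟩
      rw [← map_neg]
      exact hmono _ _ (neg_le_abs _)
    have h3 : ‖φ (Y n)‖ = n := by
      rw [map_smul, smul_eq_mul, norm_mul, norm_div, norm_norm, Real.norm_natCast,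
        div_mul_cancel₀ _ (hpos n).ne']
    linarith
  obtain ⟨n, hn⟩ := exists_nat_gt (φ (∑' k, |Y k|))
  exact absurd (hle n) (not_le.2 hn)

/-- A nonnegative function whose pairing with bounded functions is controlled by the `L^p` norm
belongs to `L^q`. -/
theorem integrable_rpow_of_integral_mul_le {Ω : Type*} [MeasurableSpace Ω] {μ : Measure Ω}
    [IsFiniteMeasure μ] {p q : ℝ} (hpq : p.HolderConjugate q) {g : Ω → ℝ} (hg : Measurable g)
    (hgi : Integrable g μ) (hg0 : ∀ ω, 0 ≤ g ω) {C : ℝ}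
    (h : ∀ (X : Ω → ℝ) (M : ℝ), Measurable X → (∀ ω, 0 ≤ X ω) → (∀ ω, X ω ≤ M) →
      ∫ ω, X ω * g ω ∂μ ≤ C * (∫ ω, X ω ^ p ∂μ) ^ (1 / p)) :
    Integrable (fun ω => g ω ^ q) μ := by
  have hq := hpq.symm.pos
  have hq1 : 0 ≤ q - 1 := hpq.symm.sub_one_pos.le
  -- Testing with the (q - 1)-th power of the truncation gives I ≤ |C| I^(1/p) for I = ∫ G^q. Since
  -- I is finite, the power can be cancelled, and the bound |C|^q does not depend on n.
  let G : ℕ → Ω → ℝ := fun n ω => min (g ω) n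
  have hG0 : ∀ n ω, 0 ≤ G n ω := fun n ω => le_min (hg0 ω) n.cast_nonneg
  have hGm : ∀ n, Measurable (G n) := fun n => hg.min measurable_const
  have hGn : ∀ n ω, G n ω ≤ n := fun n ω => min_le_right _ _
  have hGg : ∀ n ω, G n ω ≤ g ω := fun n ω => min_le_left _ _
  have hI : ∀ n, ∫ ω, G n ω ^ q ∂μ ≤ |C| ^ q := by
    intro n
    have hXm : Measurable fun ω => G n ω ^ (q - 1) := (hGm n).pow_const _
    have hX0 : ∀ ω, 0 ≤ G n ω ^ (q - 1) := fun ω => Real.rpow_nonneg (hG0 n ω) _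
    have hXn : ∀ ω, G n ω ^ (q - 1) ≤ (n : ℝ) ^ (q - 1) := fun ω =>
      Real.rpow_le_rpow (hG0 n ω) (hGn n ω) hq1
    have h1 := h _ _ hXm hX0 hXn
    have h2 : ∫ ω, G n ω ^ q ∂μ ≤ ∫ ω, G n ω ^ (q - 1) * g ω ∂μ := by
      refine integral_mono_of_nonneg (.of_forall fun ω => Real.rpow_nonneg (hG0 n ω) _)
        (hgi.bdd_mul (c := (n : ℝ) ^ (q - 1)) hXm.aestronglyMeasurable (.of_forall fun ω => ?_))
        (.of_forall fun ω => ?_)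
      · rw [Real.norm_of_nonneg (hX0 ω)]
        exact hXn ω
      · calc G n ω ^ q = G n ω ^ (q - 1) * G n ω := by
              rw [← Real.rpow_add_one' (hG0 n ω) (by simpa using hq.ne'), sub_add_cancel]
          _ ≤ _ := mul_le_mul_of_nonneg_left (hGg n ω) (hX0 ω)
    have h3 : ∀ ω, (G n ω ^ (q - 1)) ^ p = G n ω ^ q := fun ω => by
      rw [← Real.rpow_mul (hG0 n ω), hpq.symm.sub_one_mul_conj]
    simp_rw [h3] at h1
    set I := ∫ ω, G n ω ^ q ∂μ with hIdef
    have hI0 : 0 ≤ I := integral_nonneg fun ω => Real.rpow_nonneg (hG0 n ω) _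
    rcases hI0.eq_or_lt with hI0 | hI0
    · rw [← hI0]
      positivity
    have h4 : I ^ (1 / q) * I ^ (1 / p) ≤ |C| * I ^ (1 / p) := by
      rw [← Real.rpow_add hI0, one_div, one_div, hpq.symm.inv_add_inv_eq_one, Real.rpow_one,
        ← one_div]
      exact (h2.trans h1).trans (mul_le_mul_of_nonneg_right (le_abs_self C) (by positivity))
    have h5 : I ^ (1 / q) ≤ |C| := le_of_mul_le_mul_right h4 (by positivity)
    calc I = (I ^ (1 / q)) ^ q := by
          rw [← Real.rpow_mul hI0.le, one_div_mul_cancel hq.ne', Real.rpow_one]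
      _ ≤ |C| ^ q := by gcongr
  have hlim : Filter.Tendsto (fun n => ∫⁻ ω, ENNReal.ofReal (G n ω ^ q) ∂μ) Filter.atTop
      (nhds (∫⁻ ω, ENNReal.ofReal (g ω ^ q) ∂μ)) := by
    refine lintegral_tendsto_of_tendsto_of_monotone
      (fun n => ((hGm n).pow_const _).ennreal_ofReal.aemeasurable)
      (.of_forall fun ω m n hmn => ?_) (.of_forall fun ω => ?_)
    · refine ENNReal.ofReal_le_ofReal (Real.rpow_le_rpow (hG0 m ω) ?_ hq.le)
      exact min_le_min_left _ (Nat.cast_le.2 hmn)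
    · refine tendsto_const_nhds.congr' ?_
      obtain ⟨N, hN⟩ := exists_nat_ge (g ω)
      filter_upwards [Filter.eventually_ge_atTop N] with n hn
      have : G n ω = g ω := min_eq_left (hN.trans (Nat.cast_le.2 hn))
      rw [this]
  have hfin : ∫⁻ ω, ENNReal.ofReal (g ω ^ q) ∂μ ≤ ENNReal.ofReal (|C| ^ q) := by
    refine le_of_tendsto' hlim fun n => ?_
    have hint : Integrable (fun ω => G n ω ^ q) μ := by
      refine Integrable.of_bound ((hGm n).pow_const _).aestronglyMeasurable ((n : ℝ) ^ q)
        (.of_forall fun ω => ?_)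
      rw [Real.norm_of_nonneg (Real.rpow_nonneg (hG0 n ω) _)]
      exact Real.rpow_le_rpow (hG0 n ω) (hGn n ω) hq.le
    rw [← ofReal_integral_eq_lintegral_ofReal hint
      (.of_forall fun ω => Real.rpow_nonneg (hG0 n ω) _)]
    exact ENNReal.ofReal_le_ofReal (hI n)
  refine ⟨(hg.pow_const _).aestronglyMeasurable, ?_⟩
  rw [hasFiniteIntegral_iff_ofReal (.of_forall fun ω => Real.rpow_nonneg (hg0 ω) _)]
  exact hfin.trans_lt ENNReal.ofReal_lt_top

/-! ### Positive functionals on L^p as expectations -/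

section Representation

variable {Ω : Type*} [MeasurableSpace Ω]

/-- A bounded linear functional on `L^p`, `p ≤ 2`, is represented on `L²` by an `L²` function. -/
theorem exists_memLp_two_repr {ℙ : Measure Ω} [IsProbabilityMeasure ℙ] {p : ℝ≥0∞}
    [Fact (1 ≤ p)] (hp₂ : p ≤ 2) (φ : Lp ℝ p ℙ →ₗ[ℝ] ℝ) {C : ℝ} (hC : ∀ X, ‖φ X‖ ≤ C * ‖X‖) :
    ∃ g : Ω → ℝ, Measurable g ∧ MemLp g 2 ℙ ∧
      ∀ (X : Ω → ℝ) (hX : MemLp X 2 ℙ), φ ((hX.mono_exponent hp₂).toLp X) = ∫ ω, X ω * g ω ∂ℙ := by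
  replace hC : ∀ X, ‖φ X‖ ≤ |C| * ‖X‖ := fun X =>
    (hC X).trans (mul_le_mul_of_nonneg_right (le_abs_self C) (norm_nonneg X))
  -- On a probability space L² embeds contractively into L^p, so Riesz representation in L² applies
  -- to φ ∘ ι.
  let ι : Lp ℝ 2 ℙ →ₗ[ℝ] Lp ℝ p ℙ :=
    { toFun := fun X => ((Lp.memLp X).mono_exponent hp₂).toLp X
      map_add' := fun X Y => by
        rw [← MemLp.toLp_add]
        exact MemLp.toLp_congr _ _ (Lp.coeFn_add X Y)
      map_smul' := fun c X => by
        rw [RingHom.id_apply, ← MemLp.toLp_const_smul]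
        exact MemLp.toLp_congr _ _ (Lp.coeFn_smul c X) }
  have hι : ∀ X, ‖ι X‖ ≤ ‖X‖ := by
    intro X
    change ‖((Lp.memLp X).mono_exponent hp₂).toLp X‖ ≤ ‖X‖
    rw [Lp.norm_toLp, Lp.norm_def]
    exact ENNReal.toReal_mono (Lp.eLpNorm_ne_top X)
      (eLpNorm_le_eLpNorm_of_exponent_le hp₂ (Lp.aestronglyMeasurable X))
  let ψ : StrongDual ℝ (Lp ℝ 2 ℙ) := (φ.comp ι).mkContinuous |C| fun X =>
    (hC (ι X)).trans (mul_le_mul_of_nonneg_left (hι X) (abs_nonneg C))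
  let g : Lp ℝ 2 ℙ := (InnerProductSpace.toDual ℝ (Lp ℝ 2 ℙ)).symm ψ
  refine ⟨g, (Lp.stronglyMeasurable g).measurable, Lp.memLp g, fun X hX => ?_⟩
  have h1 : (hX.mono_exponent hp₂).toLp X = ι (hX.toLp X) :=
    MemLp.toLp_congr _ ((Lp.memLp _).mono_exponent hp₂) hX.coeFn_toLp.symm
  have h2 : ψ (hX.toLp X) = inner ℝ g (hX.toLp X) :=
    (InnerProductSpace.toDual_symm_apply (𝕜 := ℝ)).symm
  rw [h1, show φ (ι (hX.toLp X)) = ψ (hX.toLp X) from rfl, h2, L2.inner_def]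
  refine integral_congr_ae ?_
  filter_upwards [hX.coeFn_toLp] with ω hω
  simp [hω]

/-- A positive linear functional on `L^p`, `1 < p ≤ 2`, taking the value one at the constant one is
the expectation under a probability measure with density in the conjugate space. -/
theorem exists_measure_of_nonneg {ℙ : Measure Ω} [IsProbabilityMeasure ℙ] {p : ℝ≥0∞}
    (hp₁ : 1 < p) (hp₂ : p ≤ 2) (φ : Lp ℝ p ℙ →ₗ[ℝ] ℝ) (hφ : ∀ X, 0 ≤ X → 0 ≤ φ X)
    (hφ1 : φ (Lp.const p ℙ 1) = 1) :
    ∃ P : Measure Ω, IsProbabilityMeasure P ∧ P ≪ ℙ ∧ MemLp (density ℙ P) p.conjExponent ℙ ∧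
      ∀ X : Lp ℝ p ℙ, φ X = ∫ ω, X ω ∂P := by
  have : Fact (1 ≤ p) := ⟨hp₁.le⟩
  have hpt : p ≠ ∞ := ne_top_of_le_ne_top (by norm_num) hp₂
  have hqt : p.conjExponent ≠ ∞ := by
    rw [ENNReal.conjExponent]
    simpa [tsub_eq_zero_iff_le] using hp₁
  have : Fact (1 ≤ p.conjExponent) := ⟨by rw [ENNReal.conjExponent]; exact le_self_add⟩
  have hpq : p.toReal.HolderConjugate p.conjExponent.toReal :=
    ENNReal.HolderConjugate.toReal_of_ne_top hpt hqt
  have hq0 : p.conjExponent ≠ 0 := (one_pos.trans_le (Fact.out : 1 ≤ p.conjExponent)).ne'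
  have hp0 : p ≠ 0 := (one_pos.trans hp₁).ne'
  obtain ⟨C, hC⟩ := exists_bound_of_nonneg φ hφ
  obtain ⟨g₀, hg₀m, hg₀L, hg₀⟩ := exists_memLp_two_repr hp₂ φ hC
  have hg₀0 : 0 ≤ᵐ[ℙ] g₀ := by
    refine ae_nonneg_of_forall_setIntegral_nonneg (hg₀L.integrable (by norm_num)) fun s hs _ => ?_
    have hX : MemLp (s.indicator fun _ => (1 : ℝ)) 2 ℙ :=
      memLp_indicator_const 2 hs 1 (.inr (measure_ne_top _ _))
    have h1 : ∫ ω in s, g₀ ω ∂ℙ = ∫ ω, s.indicator (fun _ => (1 : ℝ)) ω * g₀ ω ∂ℙ := by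
      rw [← integral_indicator hs]
      refine integral_congr_ae (.of_forall fun ω => ?_)
      by_cases h : ω ∈ s <;> simp [h]
    rw [h1, ← hg₀ _ hX]
    refine hφ _ ?_
    rw [← Lp.coeFn_nonneg]
    filter_upwards [(hX.mono_exponent hp₂).coeFn_toLp] with ω hω
    rw [hω]
    exact Set.indicator_nonneg (fun _ _ => zero_le_one) ω
  let g : Ω → ℝ := fun ω => max (g₀ ω) 0
  have hgm : Measurable g := hg₀m.max measurable_const
  have hg0 : ∀ ω, 0 ≤ g ω := fun ω => le_max_right _ _
  have hgg : g =ᵐ[ℙ] g₀ := by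
    filter_upwards [hg₀0] with ω hω
    exact max_eq_left hω
  have hgL : MemLp g 2 ℙ := (memLp_congr_ae hgg).2 hg₀L
  have hrep : ∀ (X : Ω → ℝ) (hX : MemLp X 2 ℙ),
      φ ((hX.mono_exponent hp₂).toLp X) = ∫ ω, X ω * g ω ∂ℙ := by
    intro X hX
    rw [hg₀ X hX]
    refine integral_congr_ae ?_
    filter_upwards [hgg] with ω hω
    rw [hω]
  have hgi : Integrable g ℙ := hgL.integrable (by norm_num)
  have hgq : MemLp g p.conjExponent ℙ := by
    rw [← integrable_norm_rpow_iff hgm.aestronglyMeasurable hq0 hqt]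
    simp_rw [Real.norm_of_nonneg (hg0 _)]
    refine integrable_rpow_of_integral_mul_le hpq hgm hgi hg0 (C := C) fun X M hXm hX0 hXM => ?_
    have hX : MemLp X 2 ℙ := MemLp.of_bound hXm.aestronglyMeasurable M
      (.of_forall fun ω => by rw [Real.norm_of_nonneg (hX0 ω)]; exact hXM ω)
    rw [← hrep X hX]
    refine (le_abs_self _).trans ((hC _).trans (le_of_eq ?_))
    rw [Lp.norm_toLp, (hX.mono_exponent hp₂).eLpNorm_eq_integral_rpow_norm hp0 hpt,
      ENNReal.toReal_ofReal (Real.rpow_nonneg (integral_nonneg fun ω => by positivity) _)]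
    simp_rw [Real.norm_of_nonneg (hX0 _), one_div]
  have hext : ∀ X : Lp ℝ p ℙ, φ X = ∫ ω, X ω * g ω ∂ℙ := by
    let T : Lp ℝ p ℙ →L[ℝ] ℝ := ((ContinuousLinearMap.mul ℝ ℝ).lpPairing ℙ p p.conjExponent).flip
      (hgq.toLp g)
    have hT : ∀ X : Lp ℝ p ℙ, T X = ∫ ω, X ω * g ω ∂ℙ := by
      intro X
      rw [ContinuousLinearMap.flip_apply, ContinuousLinearMap.lpPairing_eq_integral]
      refine integral_congr_ae ?_
      filter_upwards [hgq.coeFn_toLp] with ω hω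
      simp [hω]
    -- Both functionals are continuous on L^p, so agreement on indicators is enough.
    suffices h : ∀ X, φ X = T X from fun X => (h X).trans (hT X)
    refine Lp.induction hpt _ ?_ ?_ ?_
    · intro c s hs hμs
      have hX : MemLp (s.indicator fun _ => c) 2 ℙ :=
        memLp_indicator_const 2 hs c (.inr hμs.ne)
      have h1 : (Lp.simpleFunc.indicatorConst p hs hμs.ne c : Lp ℝ p ℙ)
          = (hX.mono_exponent hp₂).toLp _ := by
        rw [Lp.simpleFunc.coe_indicatorConst]
        rfl
      rw [h1, hT, hrep _ hX]
      refine integral_congr_ae ?_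
      filter_upwards [(hX.mono_exponent hp₂).coeFn_toLp] with ω hω
      rw [hω]
    · intro f f' _ _ _ h1 h2
      rw [map_add, map_add, h1, h2]
    · exact isClosed_eq (φ.mkContinuous C hC).continuous T.continuous
  let P : Measure Ω := ℙ.withDensity fun ω => ENNReal.ofReal (g ω)
  have hPℙ : P ≪ ℙ := withDensity_absolutelyContinuous _ _
  have hPint : ∀ X : Ω → ℝ, ∫ ω, X ω ∂P = ∫ ω, X ω * g ω ∂ℙ := by
    intro X
    rw [integral_withDensity_eq_integral_toReal_smul hgm.ennreal_ofReal
      (.of_forall fun ω => ENNReal.ofReal_lt_top)]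
    refine integral_congr_ae (.of_forall fun ω => ?_)
    simp only [ENNReal.toReal_ofReal (hg0 ω), smul_eq_mul, mul_comm]
  refine ⟨P, ⟨?_⟩, hPℙ, (memLp_congr_ae ?_).2 hgq, fun X => ?_⟩
  · rw [withDensity_apply _ MeasurableSet.univ, Measure.restrict_univ,
      ← ofReal_integral_eq_lintegral_ofReal hgi (.of_forall hg0)]
    have h1 : ∫ ω, g ω ∂ℙ = 1 := by
      rw [← hφ1, hext]
      refine integral_congr_ae ?_
      filter_upwards [Lp.coeFn_const p ℙ (1 : ℝ)] with ω hω
      rw [hω, Function.const_apply, one_mul]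
    rw [h1, ENNReal.ofReal_one]
  · filter_upwards [Measure.rnDeriv_withDensity ℙ hgm.ennreal_ofReal] with ω hω
    rw [density, hω, ENNReal.toReal_ofReal (hg0 ω)]
  · rw [hext, hPint]

end Representation

/-! ### Supporting measures and the Fatou property -/

section Duality

variable {Ω : Type*} [MeasurableSpace Ω] {ℙ : Measure Ω} [IsProbabilityMeasure ℙ] {p : ℝ≥0∞}

/-- Minimizing a convex operator over a convex family of nonnegative random variables is bounded
below by an expectation, under a single measure, minus the conjugate. -/
theorem exists_measure_iInf_add_le (hp₁ : 1 < p) (hp₂ : p ≤ 2) {ρ : Lp ℝ p ℙ → ℝ}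
    (hρ : IsConvexOperator ℙ p ρ) {H : Type*} [Nonempty H] (S : H → Lp ℝ p ℙ)
    (hS0 : ∀ η, 0 ≤ S η)
    (hS : ∀ (η₁ η₂ : H) (t : ℝ), 0 ≤ t → t ≤ 1 → ∃ η, S η ≤ t • S η₁ + (1 - t) • S η₂) :
    ∃ P : Measure Ω, IsProbabilityMeasure P ∧ P ≪ ℙ ∧ MemLp (density ℙ P) p.conjExponent ℙ ∧
      ∀ (Y : Lp ℝ p ℙ) (η : H),
        (⨅ η', ρ (S η')) + ∫ ω, Y ω ∂P - ∫ ω, S η ω ∂P ≤ ρ Y := by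
  let Φ : Lp ℝ p ℙ → ℝ := fun X => ⨅ η, ρ (S η + X)
  have hbdd : ∀ X, BddBelow (Set.range fun η => ρ (S η + X)) := by
    intro X
    refine ⟨ρ X, ?_⟩
    rintro _ ⟨η, rfl⟩
    exact hρ.monotone _ _ (le_add_of_nonneg_left (hS0 η))
  have hΦle : ∀ X η, Φ X ≤ ρ (S η + X) := fun X η => ciInf_le (hbdd X) η
  have hconv : ConvexOn ℝ Set.univ Φ := by
    refine ⟨convex_univ, fun X _ Y _ a b ha hb hab => ?_⟩
    obtain rfl : b = 1 - a := by linarith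
    refine le_of_forall_pos_le_add fun ε hε => ?_
    obtain ⟨η₁, h₁⟩ := exists_lt_of_ciInf_lt (lt_add_of_pos_right (Φ X) hε)
    obtain ⟨η₂, h₂⟩ := exists_lt_of_ciInf_lt (lt_add_of_pos_right (Φ Y) hε)
    obtain ⟨η, hη⟩ := hS η₁ η₂ a ha (by linarith)
    have h3 : ρ (S η + (a • X + (1 - a) • Y)) ≤
        ρ (a • (S η₁ + X) + (1 - a) • (S η₂ + Y)) := by
      refine hρ.monotone _ _ ?_
      have h4 : a • (S η₁ + X) + (1 - a) • (S η₂ + Y)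
          = (a • S η₁ + (1 - a) • S η₂) + (a • X + (1 - a) • Y) := by
        rw [smul_add, smul_add]
        abel
      rw [h4]
      exact add_le_add_left hη _
    have h5 := hρ.convex (S η₁ + X) (S η₂ + Y) a ha (by linarith)
    have h6 := mul_le_mul_of_nonneg_left h₁.le ha
    have h7 := mul_le_mul_of_nonneg_left h₂.le hb
    have h8 := hΦle (a • X + (1 - a) • Y) η
    simp only [smul_eq_mul]
    linarith
  obtain ⟨φ, hφ⟩ := exists_linear_le_sub_of_convexOn hconv
  have hφ0 : ∀ X, 0 ≤ X → 0 ≤ φ X := by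
    intro X hX
    have h1 : Φ (-X) ≤ Φ 0 := ciInf_mono (hbdd _) fun η =>
      hρ.monotone _ _ (by rw [add_zero]; exact add_le_of_nonpos_right (neg_nonpos.2 hX))
    have h2 := hφ (-X)
    rw [map_neg] at h2
    linarith
  have hφc : ∀ c : ℝ, φ (Lp.const p ℙ c) ≤ c := by
    intro c
    have h1 : Φ (Lp.const p ℙ c) - c ≤ Φ 0 := le_ciInf fun η => by
      have h2 := hΦle (Lp.const p ℙ c) η
      rw [hρ.constant_invariant] at h2
      rw [add_zero]
      linarith
    linarith [hφ (Lp.const p ℙ c)]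
  have hφ1 : φ (Lp.const p ℙ 1) = 1 := by
    refine le_antisymm (hφc 1) ?_
    have h := hφc (-1)
    rw [map_neg, map_neg] at h
    linarith
  obtain ⟨P, hP, hPℙ, hPd, hPφ⟩ := exists_measure_of_nonneg hp₁ hp₂ φ hφ0 hφ1
  refine ⟨P, hP, hPℙ, hPd, fun Y η => ?_⟩
  rw [← hPφ, ← hPφ]
  -- The perturbation Y - S η turns S η into Y, so Φ there is at most ρ Y.
  have h1 := hφ (Y - S η)
  have h2 := hΦle (Y - S η) η
  have h3 : Φ 0 = ⨅ η', ρ (S η') := by simp only [Φ, add_zero]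
  rw [add_sub_cancel] at h2
  rw [map_sub] at h1
  rw [← h3]
  linarith

theorem integrable_of_memLp_density (hp₁ : 1 ≤ p) {P : Measure Ω} [IsProbabilityMeasure P]
    (hPℙ : P ≪ ℙ) (hPd : MemLp (density ℙ P) p.conjExponent ℙ) {X : Ω → ℝ} (hX : MemLp X p ℙ) :
    Integrable X P := by
  have : Fact (1 ≤ p) := ⟨hp₁⟩
  rw [← integrable_rnDeriv_smul_iff hPℙ]
  exact hX.integrable_mul hPd |>.congr (.of_forall fun ω => mul_comm _ _)

/-- Convex operators have the Fatou property on nonnegative random variables. -/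
theorem le_of_tendsto_ae (hp₁ : 1 < p) (hp₂ : p ≤ 2) {ρ : Lp ℝ p ℙ → ℝ}
    (hρ : IsConvexOperator ℙ p ρ) {X : ℕ → Lp ℝ p ℙ} {X' : Lp ℝ p ℙ} {c : ℕ → ℝ} {V : ℝ}
    (hX : ∀ n, 0 ≤ X n) (hX' : 0 ≤ X')
    (hlim : ∀ᵐ ω ∂ℙ, Filter.Tendsto (fun n => X n ω) Filter.atTop (nhds (X' ω)))
    (hc : ∀ n, ρ (X n) ≤ c n) (hcV : Filter.Tendsto c Filter.atTop (nhds V)) : ρ X' ≤ V := by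
  -- For the constant family, P supports ρ at X' itself, and the claim reduces to the classical
  -- Fatou lemma under P.
  obtain ⟨P, hP, hPℙ, hPd, hsub⟩ := exists_measure_iInf_add_le hp₁ hp₂ hρ (H := Unit)
    (fun _ => X') (fun _ => hX') fun _ _ t _ _ => ⟨(), by rw [← add_smul, add_sub_cancel, one_smul]⟩
  have hint : ∀ Y : Lp ℝ p ℙ, Integrable Y P := fun Y =>
    integrable_of_memLp_density hp₁.le hPℙ hPd (Lp.memLp Y)
  have hnn : ∀ Y : Lp ℝ p ℙ, 0 ≤ Y → 0 ≤ᵐ[P] Y := fun Y hY =>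
    hPℙ.ae_le ((Lp.coeFn_nonneg Y).2 hY)
  set a := ∫ ω, X' ω ∂P with ha
  have hle : ∀ n, ∫ ω, X n ω ∂P ≤ c n - ρ X' + a := by
    intro n
    have h := hsub (X n) ()
    rw [ciInf_const] at h
    linarith [hc n]
  have hlimc : Filter.Tendsto (fun n => c n - ρ X' + a) Filter.atTop (nhds (V - ρ X' + a)) :=
    (hcV.sub_const _).add_const _
  have hb0 : 0 ≤ V - ρ X' + a :=
    ge_of_tendsto' hlimc fun n => (integral_nonneg_of_ae (hnn _ (hX n))).trans (hle n)
  have hfatou : ENNReal.ofReal a ≤ ENNReal.ofReal (V - ρ X' + a) := by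
    rw [ha, ofReal_integral_eq_lintegral_ofReal (hint X') (hnn _ hX')]
    calc ∫⁻ ω, ENNReal.ofReal (X' ω) ∂P
        = ∫⁻ ω, Filter.liminf (fun n => ENNReal.ofReal (X n ω)) Filter.atTop ∂P := by
          refine lintegral_congr_ae ?_
          filter_upwards [hPℙ.ae_le hlim] with ω hω
          exact (ENNReal.tendsto_ofReal hω).liminf_eq.symm
      _ ≤ Filter.liminf (fun n => ∫⁻ ω, ENNReal.ofReal (X n ω) ∂P) Filter.atTop :=
          lintegral_liminf_le fun n =>
            (Lp.stronglyMeasurable (X n)).measurable.ennreal_ofReal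
      _ ≤ Filter.liminf (fun n => ENNReal.ofReal (c n - ρ X' + a)) Filter.atTop := by
          refine Filter.liminf_le_liminf (.of_forall fun n => ?_)
          rw [← ofReal_integral_eq_lintegral_ofReal (hint (X n)) (hnn _ (hX n))]
          exact ENNReal.ofReal_le_ofReal (hle n)
      _ = ENNReal.ofReal (V - ρ X' + a) := (ENNReal.tendsto_ofReal hlimc).liminf_eq
  linarith [(ENNReal.ofReal_le_ofReal_iff hb0).1 hfatou]

end Duality

/-! ### Conditional expectation and change of measure -/

/-- Conditional expectation preserves `L^r`. -/
theorem memLp_condExp {Ω : Type*} {𝒞 : MeasurableSpace Ω} {mΩ : MeasurableSpace Ω} (h𝒞 : 𝒞 ≤ mΩ)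
    {Q : Measure Ω} [IsFiniteMeasure Q] {r : ℝ≥0∞} (hr : 1 ≤ r) (hrt : r ≠ ∞) {f : Ω → ℝ}
    (hf : MemLp f r Q) : MemLp (Q[f | 𝒞]) r Q := by
  have hr0 : r ≠ 0 := (one_pos.trans_le hr).ne'
  have hm : AEStronglyMeasurable (Q[f | 𝒞]) Q :=
    (stronglyMeasurable_condExp.mono h𝒞).aestronglyMeasurable
  have hfi : Integrable (fun ω => ‖f ω‖ ^ r.toReal) Q :=
    (integrable_norm_rpow_iff hf.1 hr0 hrt).2 hf
  rw [← integrable_norm_rpow_iff hm hr0 hrt]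
  refine (integrable_condExp (m := 𝒞) (f := fun ω => ‖f ω‖ ^ r.toReal)).mono'
    (hm.norm.aemeasurable.pow_const _).aestronglyMeasurable ?_
  have hr1 : 1 ≤ r.toReal := by
    rw [← ENNReal.toReal_one]
    exact ENNReal.toReal_mono hrt hr
  filter_upwards [Integrable.norm_condExp_rpow_le (m := 𝒞) hr1 hfi] with ω hω
  rw [Real.norm_of_nonneg (by positivity)]
  exact hω

/-- The change of measure from `P` to a measure with density `f^P / 𝔼[f^P | 𝒞]`: the latter agrees
with `ℙ` on `𝒞`, and its density with respect to `P` is `𝒞`-measurable. -/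
theorem trim_eq_and_density_eq_mul {Ω : Type*} {𝒞 : MeasurableSpace Ω} {mΩ : MeasurableSpace Ω}
    (h𝒞 : 𝒞 ≤ mΩ) {ℙ P Q : Measure Ω} [IsProbabilityMeasure ℙ] [IsProbabilityMeasure P]
    [IsProbabilityMeasure Q] (hPℙ : P ≪ ℙ) (hℙP : ℙ ≪ P) (hQℙ : Q ≪ ℙ)
    (hQ : density ℙ Q =ᵐ[ℙ] conditionalDensity 𝒞 ℙ P) :
    Q.trim h𝒞 = ℙ.trim h𝒞 ∧
      density ℙ P =ᵐ[ℙ] fun ω => density ℙ Q ω * (ℙ[density ℙ P | 𝒞]) ω := by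
  set f := density ℙ P with hf
  set m := ℙ[f | 𝒞] with hm
  have hmm : StronglyMeasurable[𝒞] m := stronglyMeasurable_condExp
  have hfi : Integrable f ℙ := Measure.integrable_toReal_rnDeriv
  -- The zero set of m lies in 𝒞, so its P-mass is the integral of m over it, which is 0; ℙ ≪ P
  -- makes it ℙ-null.
  have hm0 : ∀ᵐ ω ∂ℙ, m ω ≠ 0 := by
    have hs : MeasurableSet[𝒞] {ω | m ω = 0} := hmm.measurable (measurableSet_singleton 0)
    have h1 : ∫ ω in {ω | m ω = 0}, f ω ∂ℙ = 0 := by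
      rw [← setIntegral_condExp h𝒞 hfi hs]
      exact setIntegral_eq_zero_of_forall_eq_zero fun ω hω => hω
    have h2 : P.real {ω | m ω = 0} = 0 := by
      exact (Measure.setIntegral_toReal_rnDeriv hPℙ _).symm.trans h1
    have h3 : P {ω | m ω = 0} = 0 := (measureReal_eq_zero_iff).1 h2
    simpa [ae_iff] using hℙP h3
  have hQm : density ℙ Q =ᵐ[ℙ] f * m⁻¹ := by
    filter_upwards [hQ] with ω hω
    rw [hω, conditionalDensity, div_eq_mul_inv]
    rfl
  refine ⟨?_, ?_⟩
  · have hQi : Integrable (f * m⁻¹) ℙ := Measure.integrable_toReal_rnDeriv.congr hQm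
    have hone : ℙ[f * m⁻¹ | 𝒞] =ᵐ[ℙ] fun _ => 1 := by
      have hminv : StronglyMeasurable[𝒞] m⁻¹ := hmm.measurable.inv.stronglyMeasurable
      filter_upwards [condExp_mul_of_stronglyMeasurable_right hminv hQi hfi, hm0] with ω h1 h2
      rw [h1, Pi.mul_apply, Pi.inv_apply, ← hm, mul_inv_cancel₀ h2]
    refine @Measure.ext _ 𝒞 _ _ fun s hs => ?_
    rw [trim_measurableSet_eq h𝒞 hs, trim_measurableSet_eq h𝒞 hs]
    have h1 : Q.real s = ℙ.real s := by
      rw [← Measure.setIntegral_toReal_rnDeriv hQℙ s]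
      calc ∫ ω in s, density ℙ Q ω ∂ℙ = ∫ ω in s, (f * m⁻¹) ω ∂ℙ :=
            integral_congr_ae (ae_restrict_of_ae hQm)
        _ = ∫ ω in s, (ℙ[f * m⁻¹ | 𝒞]) ω ∂ℙ := (setIntegral_condExp h𝒞 hQi hs).symm
        _ = ∫ ω in s, (1 : ℝ) ∂ℙ := integral_congr_ae (ae_restrict_of_ae hone)
        _ = ℙ.real s := by simp
    exact (measureReal_eq_measureReal_iff).1 h1
  · filter_upwards [hQm, hm0] with ω h1 h2
    rw [h1, Pi.mul_apply, Pi.inv_apply, inv_mul_cancel_right₀ h2]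

theorem memLp_two_of_memLp_two_mul {Ω : Type*} [MeasurableSpace Ω] {ℙ P : Measure Ω}
    [IsProbabilityMeasure ℙ] [IsProbabilityMeasure P] {p : ℝ≥0∞} (hp₁ : 1 ≤ p) (hPℙ : P ≪ ℙ)
    (hPd : MemLp (density ℙ P) p.conjExponent ℙ) {X : Ω → ℝ} (hX : MemLp X (2 * p) ℙ) :
    MemLp X 2 P := by
  rw [memLp_two_iff_integrable_sq (hX.1.mono_ac hPℙ)]
  have ht : ENNReal.HolderTriple (2 * p) (2 * p) p := by
    refine ⟨?_⟩
    rw [ENNReal.mul_inv (Or.inl (by norm_num)) (Or.inl (by norm_num)), ← add_mul,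
      ENNReal.inv_two_add_inv_two, one_mul]
  refine integrable_of_memLp_density hp₁ hPℙ hPd ?_
  simpa only [sq, Pi.mul_def] using hX.mul hX

/-- Here |X|^(2p) lies in L²(ℙ), hence in L^p(ℙ) because p ≤ 2, and pairs with the L^q density. This
is where the exponent 4p is needed. -/
theorem memLp_two_mul_of_memLp_four_mul {Ω : Type*} [MeasurableSpace Ω] {ℙ Q : Measure Ω}
    [IsProbabilityMeasure ℙ] [IsProbabilityMeasure Q] {p : ℝ≥0∞} (hp₁ : 1 ≤ p) (hp₂ : p ≤ 2)
    (hQℙ : Q ≪ ℙ) (hQd : MemLp (density ℙ Q) p.conjExponent ℙ) {X : Ω → ℝ}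
    (hX : MemLp X (4 * p) ℙ) : MemLp X (2 * p) Q := by
  have hp0 : p ≠ 0 := (one_pos.trans_le hp₁).ne'
  have hpt : p ≠ ∞ := ne_top_of_le_ne_top (by norm_num) hp₂
  rw [← integrable_norm_rpow_iff (hX.1.mono_ac hQℙ) (by simpa using hp0)
    (ENNReal.mul_ne_top (by norm_num) hpt)]
  refine integrable_of_memLp_density hp₁ hQℙ hQd ?_
  have h := hX.norm_rpow_div (2 * p)
  have h2 : 4 * p / (2 * p) = 2 := by
    rw [ENNReal.mul_div_mul_right _ _ hp0 hpt, show (4 : ℝ≥0∞) = 2 * 2 by norm_num,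
      ENNReal.mul_div_cancel_right (by norm_num) (by norm_num)]
  rw [h2] at h
  exact h.mono_exponent hp₂

/-- Under stability, the conditional expectation of `ξ` under an equivalent `P` in the representation
set is a square integrable projection which belongs to `L^{2p}(ℙ)`. -/
theorem exists_projection {Ω : Type*} {𝒞 : MeasurableSpace Ω} {mΩ : MeasurableSpace Ω}
    (h𝒞 : 𝒞 ≤ mΩ) {ℙ P Q : Measure Ω} [IsProbabilityMeasure ℙ] [IsProbabilityMeasure P]
    [IsProbabilityMeasure Q] {p : ℝ≥0∞} (hp₁ : 1 ≤ p) (hp₂ : p ≤ 2) (hPℙ : P ≪ ℙ) (hℙP : ℙ ≪ P)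
    (hPd : MemLp (density ℙ P) p.conjExponent ℙ) (hQℙ : Q ≪ ℙ)
    (hQd : MemLp (density ℙ Q) p.conjExponent ℙ)
    (hQ : density ℙ Q =ᵐ[ℙ] conditionalDensity 𝒞 ℙ P) (ξ : Lp ℝ (4 * p) ℙ) :
    ∃ η' : lpMeas ℝ ℝ 𝒞 (2 * p) ℙ, ∀ η : lpMeas ℝ ℝ 𝒞 (2 * p) ℙ,
      Integrable (fun ω => ((η : Lp ℝ (2 * p) ℙ) ω - (η' : Lp ℝ (2 * p) ℙ) ω) ^ 2) P ∧
      ∫ ω, (ξ ω - (η : Lp ℝ (2 * p) ℙ) ω) ^ 2 ∂P = ∫ ω, (ξ ω - (η' : Lp ℝ (2 * p) ℙ) ω) ^ 2 ∂P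
        + ∫ ω, ((η : Lp ℝ (2 * p) ℙ) ω - (η' : Lp ℝ (2 * p) ℙ) ω) ^ 2 ∂P := by
  have hpt : p ≠ ∞ := ne_top_of_le_ne_top (by norm_num) hp₂
  have h2p : 1 ≤ 2 * p := one_le_mul one_le_two hp₁
  have h2pt : 2 * p ≠ ∞ := ENNReal.mul_ne_top (by norm_num) hpt
  obtain ⟨htrim, hmul⟩ := trim_eq_and_density_eq_mul h𝒞 hPℙ hℙP hQℙ hQ
  set m := ℙ[density ℙ P | 𝒞]
  have hmm : StronglyMeasurable[𝒞] m := stronglyMeasurable_condExp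
  have hξQ : MemLp ξ (2 * p) Q := memLp_two_mul_of_memLp_four_mul hp₁ hp₂ hQℙ hQd (Lp.memLp ξ)
  have hξi : Integrable ξ Q := hξQ.integrable h2p
  set h : Ω → ℝ := Q[ξ | 𝒞]
  have hhm : StronglyMeasurable[𝒞] h := stronglyMeasurable_condExp
  have hhQ : MemLp h (2 * p) Q := memLp_condExp h𝒞 h2p h2pt hξQ
  -- h is 𝒞-measurable and Q agrees with ℙ on 𝒞, so its norm is the same under both measures.
  have hhℙ : MemLp h (2 * p) ℙ := by
    refine ⟨(hhm.mono h𝒞).aestronglyMeasurable, ?_⟩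
    rw [← eLpNorm_trim h𝒞 hhm, ← htrim, eLpNorm_trim h𝒞 hhm]
    exact hhQ.2
  have hξP : MemLp ξ 2 P := memLp_two_of_memLp_two_mul hp₁ hPℙ hPd
    ((Lp.memLp ξ).mono_exponent (by gcongr; norm_num))
  have hhP : MemLp h 2 P := memLp_two_of_memLp_two_mul hp₁ hPℙ hPd hhℙ
  have hch : ∀ Z : Ω → ℝ, (fun ω => density ℙ P ω * Z ω) =ᵐ[ℙ]
      fun ω => density ℙ Q ω * (m ω * Z ω) := by
    intro Z
    filter_upwards [hmul] with ω hω
    rw [hω, mul_assoc]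
  have hchange : ∀ Z : Ω → ℝ, ∫ ω, Z ω ∂P = ∫ ω, m ω * Z ω ∂Q := by
    intro Z
    rw [← integral_toReal_rnDeriv_mul hPℙ, ← integral_toReal_rnDeriv_mul hQℙ]
    exact integral_congr_ae (hch Z)
  have hchangei : ∀ Z : Ω → ℝ, Integrable Z P → Integrable (fun ω => m ω * Z ω) Q := by
    intro Z hZ
    rw [← integrable_toReal_rnDeriv_mul_iff hPℙ] at hZ
    rw [← integrable_toReal_rnDeriv_mul_iff hQℙ]
    exact hZ.congr (hch Z)
  have hη'm : hhℙ.toLp h ∈ lpMeas ℝ ℝ 𝒞 (2 * p) ℙ :=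
    mem_lpMeas_iff_aestronglyMeasurable.2
      (hhm.aestronglyMeasurable.congr hhℙ.coeFn_toLp.symm)
  refine ⟨⟨hhℙ.toLp h, hη'm⟩, fun η => ?_⟩
  obtain ⟨k, hkm, hk⟩ := lpMeas.aestronglyMeasurable η
  have hkP : MemLp k 2 P := memLp_two_of_memLp_two_mul hp₁ hPℙ hPd
    ((memLp_congr_ae hk).1 (Lp.memLp (η : Lp ℝ (2 * p) ℙ)))
  have hY : MemLp (fun ω => ξ ω - h ω) 2 P := hξP.sub hhP
  have hW : MemLp (fun ω => k ω - h ω) 2 P := hkP.sub hhP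
  have hYi : Integrable (⇑ξ - h) Q := hξi.sub integrable_condExp
  have hYW : Integrable (fun ω => (ξ ω - h ω) * (k ω - h ω)) P := hY.integrable_mul hW
  have hYc : Q[⇑ξ - h | 𝒞] =ᵐ[Q] 0 := by
    filter_upwards [condExp_sub hξi (integrable_condExp : Integrable h Q) 𝒞] with ω hω
    rw [hω, Pi.sub_apply, condExp_of_stronglyMeasurable h𝒞 hhm integrable_condExp]
    exact sub_self _
  -- Passing to Q costs the 𝒞-measurable factor m, so m (k - h) comes out of the conditional
  -- expectation and leaves Q[ξ - h | 𝒞] = 0.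
  have horth : ∫ ω, (ξ ω - h ω) * (k ω - h ω) ∂P = 0 := by
    have hmW : StronglyMeasurable[𝒞] fun ω => m ω * (k ω - h ω) := hmm.mul (hkm.sub hhm)
    have heq : (fun ω => m ω * ((ξ ω - h ω) * (k ω - h ω)))
        = (fun ω => m ω * (k ω - h ω)) * (⇑ξ - h) := by
      funext ω
      simp only [Pi.mul_apply, Pi.sub_apply]
      ring
    have hint := hchangei _ hYW
    rw [heq] at hint
    rw [hchange, heq, ← integral_condExp h𝒞]
    refine (integral_congr_ae (g := 0) ?_).trans (integral_zero _ _)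
    filter_upwards [condExp_mul_of_stronglyMeasurable_left hmW hint hYi, hYc] with ω h1 h2
    rw [h1, Pi.mul_apply, h2]
    simp
  have hη'P := hPℙ.ae_le hhℙ.coeFn_toLp
  have hηP := hPℙ.ae_le hk
  refine ⟨?_, ?_⟩
  · refine hW.integrable_sq.congr ?_
    filter_upwards [hη'P, hηP] with ω h1 h2
    rw [h1, h2]
  · have e1 : ∫ ω, (ξ ω - (η : Lp ℝ (2 * p) ℙ) ω) ^ 2 ∂P
        = ∫ ω, ((ξ ω - h ω) ^ 2 + (k ω - h ω) ^ 2 - 2 * ((ξ ω - h ω) * (k ω - h ω))) ∂P := by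
      refine integral_congr_ae ?_
      filter_upwards [hηP] with ω h2
      rw [h2]
      ring
    have e2 : ∫ ω, (ξ ω - hhℙ.toLp h ω) ^ 2 ∂P = ∫ ω, (ξ ω - h ω) ^ 2 ∂P := by
      refine integral_congr_ae ?_
      filter_upwards [hη'P] with ω h1
      rw [h1]
    have e3 : ∫ ω, ((η : Lp ℝ (2 * p) ℙ) ω - hhℙ.toLp h ω) ^ 2 ∂P
        = ∫ ω, (k ω - h ω) ^ 2 ∂P := by
      refine integral_congr_ae ?_
      filter_upwards [hη'P, hηP] with ω h1 h2
      rw [h1, h2]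
    rw [e1, e2, e3, integral_sub (f := fun ω => (ξ ω - h ω) ^ 2 + (k ω - h ω) ^ 2)
      (hY.integrable_sq.add hW.integrable_sq) (hYW.const_mul 2),
      integral_add hY.integrable_sq hW.integrable_sq, integral_const_mul, horth]
    ring

theorem penalty_lt_top {Ω : Type*} [MeasurableSpace Ω] {ℙ : Measure Ω} {p : ℝ≥0∞}
    {ρ : Lp ℝ p ℙ → ℝ} {P : Measure Ω} {c : ℝ} (h : ∀ ζ : Lp ℝ p ℙ, ∫ ω, ζ ω ∂P ≤ ρ ζ + c) : penalty ρ P < ⊤ := by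
  refine lt_of_le_of_lt (iSup₂_le fun ζ hζ => ?_) (EReal.coe_lt_top c)
  have hζ : ρ ζ ≤ 0 := hζ
  exact EReal.coe_le_coe_iff.2 (by linarith [h ζ])

/-! ### The squared error and almost sure subsequences -/

section SquaredError

variable {Ω : Type*} [MeasurableSpace Ω] {ℙ : Measure Ω} [IsProbabilityMeasure ℙ] {p : ℝ≥0∞}

theorem coeFn_sqError (ξ : Lp ℝ (4 * p) ℙ) (η : Lp ℝ (2 * p) ℙ) :
    sqError ξ η =ᵐ[ℙ] fun ω => (ξ ω - η ω) ^ 2 :=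
  (memLp_sq_sub ξ η).coeFn_toLp

theorem sqError_nonneg (ξ : Lp ℝ (4 * p) ℙ) (η : Lp ℝ (2 * p) ℙ) : 0 ≤ sqError ξ η := by
  rw [← Lp.coeFn_nonneg]
  filter_upwards [coeFn_sqError ξ η] with ω hω
  rw [hω]
  exact sq_nonneg _

theorem sqError_convex (ξ : Lp ℝ (4 * p) ℙ) (η₁ η₂ : Lp ℝ (2 * p) ℙ) {t : ℝ} (h0 : 0 ≤ t)
    (h1 : t ≤ 1) :
    sqError ξ (t • η₁ + (1 - t) • η₂) ≤ t • sqError ξ η₁ + (1 - t) • sqError ξ η₂ := by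
  rw [← Lp.coeFn_le]
  filter_upwards [coeFn_sqError ξ (t • η₁ + (1 - t) • η₂), coeFn_sqError ξ η₁,
    coeFn_sqError ξ η₂, Lp.coeFn_add (t • η₁) ((1 - t) • η₂), Lp.coeFn_smul t η₁,
    Lp.coeFn_smul (1 - t) η₂, Lp.coeFn_add (t • sqError ξ η₁) ((1 - t) • sqError ξ η₂),
    Lp.coeFn_smul t (sqError ξ η₁), Lp.coeFn_smul (1 - t) (sqError ξ η₂)]
    with ω e1 e2 e3 e4 e5 e6 e7 e8 e9
  rw [e1, e4, e7]
  simp only [Pi.add_apply]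
  rw [e5, e6, e8, e9]
  simp only [Pi.smul_apply, smul_eq_mul]
  rw [e2, e3]
  -- The convexity gap is exactly t (1 - t) (η₁ - η₂)².
  nlinarith [mul_nonneg (mul_nonneg h0 (sub_nonneg.2 h1)) (sq_nonneg (η₁ ω - η₂ ω))]

/-- A sequence of nonnegative functions whose integrals tend to zero has a subsequence which tends
to zero almost everywhere. -/
theorem exists_subseq_tendsto_zero_ae {P : Measure Ω} {u : ℕ → Ω → ℝ}
    (hu : ∀ n, Integrable (u n) P) (hu0 : ∀ n ω, 0 ≤ u n ω)
    (hlim : Filter.Tendsto (fun n => ∫ ω, u n ω ∂P) Filter.atTop (nhds 0)) :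
    ∃ ns : ℕ → ℕ, StrictMono ns ∧
      ∀ᵐ ω ∂P, Filter.Tendsto (fun n => u (ns n) ω) Filter.atTop (nhds 0) := by
  have h1 : Filter.Tendsto (fun n => eLpNorm (u n - 0) 1 P) Filter.atTop (nhds 0) := by
    have h2 : ∀ n, eLpNorm (u n - 0) 1 P = ENNReal.ofReal (∫ ω, u n ω ∂P) := by
      intro n
      rw [sub_zero, eLpNorm_one_eq_lintegral_enorm,
        ofReal_integral_eq_lintegral_ofReal (hu n) (.of_forall (hu0 n))]
      exact lintegral_congr fun ω => Real.enorm_of_nonneg (hu0 n ω)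
    simp_rw [h2]
    simpa using ENNReal.tendsto_ofReal hlim
  exact (tendstoInMeasure_of_tendsto_eLpNorm one_ne_zero (fun n => (hu n).1)
    aestronglyMeasurable_zero h1).exists_seq_tendsto_ae

end SquaredError

end ConvexMMSE

/-! ### Existence of the minimizer -/

theorem mainTheorem5 {Ω : Type*} (𝒞 : MeasurableSpace Ω) [mΩ : MeasurableSpace Ω] (h𝒞 : 𝒞 ≤ mΩ)
    (ℙ : Measure Ω) [IsProbabilityMeasure ℙ] (p : ℝ≥0∞) (hp₁ : 1 < p) (hp₂ : p ≤ 2)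
    (ρ : Lp ℝ p ℙ → ℝ) (hρ : ConvexMMSE.IsConvexOperator ℙ p ρ)
    (hnorm : ConvexMMSE.IsNormalized ρ)
    (hstable : ConvexMMSE.IsStable ρ) (hproper : ConvexMMSE.IsProper ρ)
    (ξ : Lp ℝ (4 * p) ℙ) :
    ∃ η' : lpMeas ℝ ℝ 𝒞 (2 * p) ℙ, ∀ η : lpMeas ℝ ℝ 𝒞 (2 * p) ℙ,
      ρ (ConvexMMSE.sqError ξ η') ≤ ρ (ConvexMMSE.sqError ξ η) := by
  let S : lpMeas ℝ ℝ 𝒞 (2 * p) ℙ → Lp ℝ p ℙ := fun η => ConvexMMSE.sqError ξ η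
  have hS0 : ∀ η, 0 ≤ S η := fun η => ConvexMMSE.sqError_nonneg ξ η
  set V := ⨅ η, ρ (S η) with hV
  have hVle : ∀ η, V ≤ ρ (S η) := fun η => by
    refine ciInf_le ⟨ρ 0, ?_⟩ η
    rintro _ ⟨η, rfl⟩
    exact hρ.monotone _ _ (hS0 η)
  obtain ⟨P, hP, hPℙ, hPd, hsub⟩ := ConvexMMSE.exists_measure_iInf_add_le hp₁ hp₂ hρ S hS0
    fun η₁ η₂ t h0 h1 => ⟨t • η₁ + (1 - t) • η₂, ConvexMMSE.sqError_convex ξ η₁ η₂ h0 h1⟩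
  have hPmem : P ∈ ConvexMMSE.representationSet ρ :=
    -- The constant comes from the supporting inequality at the competitor η = 0; any η would do.
    ⟨hP, hPℙ, hPd, ConvexMMSE.penalty_lt_top (c := ∫ ω, S 0 ω ∂P - V) fun ζ => by
      linarith [hsub ζ 0]⟩
  have hℙP : ℙ ≪ P := (hproper P hPmem).2
  obtain ⟨Q, ⟨hQp, hQℙ, hQd, -⟩, hQ⟩ := hstable P hPmem 𝒞 h𝒞
  obtain ⟨η', hη'⟩ := ConvexMMSE.exists_projection h𝒞 hp₁.le hp₂ hPℙ hℙP hPd hQℙ hQd hQ ξ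
  have hSint : ∀ η, ∫ ω, S η ω ∂P = ∫ ω, (ξ ω - (η : Lp ℝ (2 * p) ℙ) ω) ^ 2 ∂P := fun η =>
    integral_congr_ae (hPℙ.ae_le (ConvexMMSE.coeFn_sqError ξ η))
  refine ⟨η', fun η => le_trans ?_ (hVle η)⟩
  have hmin : ∀ n : ℕ, ∃ η, ρ (S η) < V + 1 / ((n : ℝ) + 1) := fun n =>
    exists_lt_of_ciInf_lt (lt_add_of_pos_right _ Nat.one_div_pos_of_nat)
  choose e he using hmin
  have hone : Filter.Tendsto (fun n : ℕ => 1 / ((n : ℝ) + 1)) Filter.atTop (nhds 0) :=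
    tendsto_one_div_add_atTop_nhds_zero_nat
  obtain ⟨ns, hns, hae⟩ := ConvexMMSE.exists_subseq_tendsto_zero_ae (fun n => (hη' (e n)).1)
    (fun n ω => sq_nonneg _) (squeeze_zero (fun n => integral_nonneg fun ω => sq_nonneg _)
      (fun n => by
        -- By Pythagoras the terms ∫ (ξ - η')² cancel, leaving the squared L²(P) distance below ρ(S
        -- (e n)) - V.
        have h1 := hsub (S (e n)) η'
        rw [hSint, hSint, (hη' (e n)).2] at h1
        linarith [he n]) hone)
  refine ConvexMMSE.le_of_tendsto_ae hp₁ hp₂ hρ (X := fun n => S (e (ns n)))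
    (fun n => hS0 _) (hS0 η') ?_ (fun n => (he (ns n)).le)
    (by simpa using (hone.comp hns.tendsto_atTop).const_add V)
  filter_upwards [hℙP.ae_le hae, ConvexMMSE.coeFn_sqError ξ η',
    ae_all_iff.2 fun n => ConvexMMSE.coeFn_sqError ξ (e (ns n) : Lp ℝ (2 * p) ℙ)] with ω h1 h2 h3
  have h4 : Filter.Tendsto (fun n => (e (ns n) : Lp ℝ (2 * p) ℙ) ω - (η' : Lp ℝ (2 * p) ℙ) ω)
      Filter.atTop (nhds 0) := by
    rw [tendsto_zero_iff_abs_tendsto_zero]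
    simpa [Function.comp_def, Real.sqrt_sq_eq_abs] using h1.sqrt
  have h5 := tendsto_sub_nhds_zero_iff.1 h4
  change Filter.Tendsto (fun n => ConvexMMSE.sqError ξ (e (ns n) : Lp ℝ (2 * p) ℙ) ω) _
    (nhds (ConvexMMSE.sqError ξ (η' : Lp ℝ (2 * p) ℙ) ω))
  simp_rw [h2, h3]
  exact (tendsto_const_nhds.sub h5).pow 2
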